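/- Consider a downlink system with $K$ users, $M$ sub-carriers, $N$ time slots and $N_T$ transmit antennas, channel vectors $\mathbf h_k[m]\in\mathbb C^{N_T}$, $\mathbf H_k[m]=\mathbf h_k[m]\mathbf h_k^H[m]$, noise power $\sigma^2>0$, power budget $P_{\max}\in\mathbb R$, packet error probabilities $\epsilon_k\in(0,\tfrac12)$, weights $\mu_k>0$, required numbers of bits $B_k\in\mathbb R$, at least one of which is positive, and deadlines $D_k\in\mathbb N$. Let $a=\log_2 e$ and let $Q^{-1}$ be the inverse of the Gaussian Q-function $Q(x)=\frac1{\sqrt{2\pi}}\int_x^\infty e^{-t^2/2}\,dt$. For matrices $\mathbf W=(\mathbf W_k[m,n])$ in $\mathbb C^{N_T\times N_T}$ and real numbers $\mathbf z=(z_k[m,n])$, $k\le K$, $m\le M$, $n\le N$, put $$\gamma_k[m,n](\mathbf W)=\frac{\mathrm{Tr}(\mathbf H_k[m]\mathbf W_k[m,n])}{\sum_{l\ne k}\mathrm{Tr}(\mathbf H_k[m]\mathbf W_l[m,n])+\sigma^2},$$ $$F_k(\mathbf z)=\sum_{m,n}\log_2(1+z_k[m,n]),\qquad V_k(\mathbf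 z)=a\,Q^{-1}(\epsilon_k)\sqrt{\sum_{m,n}\bigl(1-(1+z_k[m,n])^{-2}\bigr)},\qquad U(\mathbf z)=\sum_k\mu_k\bigl(F_k(\mathbf z)-V_k(\mathbf z)\bigr).$$ Consider the constraints C2: $\sum_{k,m,n}\mathrm{Tr}(\mathbf W_k[m,n])\le P_{\max}$; C3: $\mathrm{Tr}(\mathbf W_k[m,n])=0$ for all $k,m$ and all $n>D_k$; C4: $\mathbf W_k[m,n]\succeq 0$ for all $k,m,n$. Rank-constrained problem (variable $\mathbf W$): maximize $U(\gamma(\mathbf W))$ subject to $F_k(\gamma(\mathbf W))-V_k(\gamma(\mathbf W))\ge B_k$ for all $k$, C2, C3, C4, and $\mathrm{rank}\,\mathbf W_k[m,n]\le1$ for all $k,m,n$. Relaxed problem (variables $\mathbf W,\mathbf z$): maximize $U(\mathbf z)$ subject to $F_k(\mathbf z)-V_k(\mathbf z)\ge B_k$ for all $k$, C2, C3, C4, $z_k[m,n]\le\gamma_k[m,n](\mathbf W)$ (C6) and $z_k[m,n]\ge0$ for all $k,m,n$. Then the two problems are equivalent in the following sense. (1) $\mathbf W$ is an optimal solution of the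 rank-constrained problem if and only if $(\mathbf W,\mathbf z)$ is an optimal solution of the relaxed problem for some $\mathbf z$. (2) Every optimal solution $(\mathbf W,\mathbf z)$ of the relaxed problem satisfies C6 with equality, $z_k[m,n]=\gamma_k[m,n](\mathbf W)$ for all $k,m,n$, and $\mathrm{rank}\,\mathbf W_k[m,n]\le 1$ for all $k,m,n$. (3) The optimal values agree whenever both problems have optimal solutions. (4) If one of the problems is feasible, then both have optimal solutions. -/

import Mathlib

open scoped ComplexOrder

noncomputable section

namespace URLLC

/-- The parameters of a downlink MISO OFDMA-URLLC system with `K` users, `M` sub-carriers,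
`N` time slots and `NT` transmit antennas at the base station. -/
structure System (K M N NT : ℕ) where
  /-- channel vector of user `k` on sub-carrier `m` -/
  h : Fin K → Fin M → Fin NT → ℂ
  /-- noise standard deviation (the noise power is `σ ^ 2`) -/
  σ : ℝ
  /-- transmit power budget of the base station -/
  Pmax : ℝ
  /-- target packet error probability of user `k` -/
  ε : Fin K → ℝ
  /-- weight of user `k` in the weighted sum throughput -/
  μ : Fin K → ℝ
  /-- minimum number of bits that user `k` has to receive -/
  B : Fin K → ℝ
  /-- number of time slots available for the transmission of the packet of user `k` -/
  D : Fin K → ℕ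

/-- A collection of matrices `W k m n`, one for every user, sub-carrier and time slot. -/
abbrev Beams (K M N NT : ℕ) : Type :=
  Fin K → Fin M → Fin N → Matrix (Fin NT) (Fin NT) ℂ

/-- A collection of real numbers `z k m n`, one for every user, sub-carrier and time slot. -/
abbrev Levels (K M N : ℕ) : Type :=
  Fin K → Fin M → Fin N → ℝ

/-- The Gaussian Q-function. -/
def gaussianQ (x : ℝ) : ℝ :=
  1 / Real.sqrt (2 * Real.pi) * ∫ t in Set.Ioi x, Real.exp (-t ^ 2 / 2)

/-- The inverse of the Gaussian Q-function (meaningful on `(0, 1)`, the range of `gaussianQ`). -/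
def gaussianQInv : ℝ → ℝ := Function.invFun gaussianQ

/-- The constant `a = log₂ e`. -/
def a : ℝ := Real.logb 2 (Real.exp 1)

variable {K M N NT : ℕ}

namespace System

/-- The matrix `H k m = h k m (h k m)ᴴ`. -/
def H (S : System K M N NT) (k : Fin K) (m : Fin M) : Matrix (Fin NT) (Fin NT) ℂ :=
  Matrix.vecMulVec (S.h k m) (star (S.h k m))

/-- Numerator of the SINR. The trace is real for Hermitian matrices. -/
def f (S : System K M N NT) (W : Beams K M N NT) (k : Fin K) (m : Fin M) (n : Fin N) : ℝ :=
  (Matrix.trace (S.H k m * W k m n)).re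

/-- Denominator of the SINR: interference of the other users plus noise. -/
def g (S : System K M N NT) (W : Beams K M N NT) (k : Fin K) (m : Fin M) (n : Fin N) : ℝ :=
  (∑ l ∈ Finset.univ.erase k, (Matrix.trace (S.H k m * W l m n)).re) + S.σ ^ 2

/-- The SINR of user `k` on sub-carrier `m` in time slot `n`. -/
def γ (S : System K M N NT) (W : Beams K M N NT) : Levels K M N :=
  fun k m n => S.f W k m n / S.g W k m n

/-- Sum of the Shannon capacities over the resource elements of user `k`, as a function of the
SINR levels. -/
def Fu (_S : System K M N NT) (k : Fin K) (z : Levels K M N) : ℝ :=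
  ∑ m, ∑ n, Real.logb 2 (1 + z k m n)

/-- Finite blocklength penalty of user `k`, as a function of the SINR levels. -/
def Vu (S : System K M N NT) (k : Fin K) (z : Levels K M N) : ℝ :=
  a * gaussianQInv (S.ε k) * Real.sqrt (∑ m, ∑ n, (1 - (1 + z k m n) ^ (-2 : ℤ)))

/-- Weighted sum of the capacity terms. -/
def F (S : System K M N NT) (z : Levels K M N) : ℝ := ∑ k, S.μ k * S.Fu k z

/-- Weighted sum of the penalty terms. -/
def V (S : System K M N NT) (z : Levels K M N) : ℝ := ∑ k, S.μ k * S.Vu k z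

/-- The weighted sum throughput, as a function of the SINR levels. -/
def U (S : System K M N NT) (z : Levels K M N) : ℝ := S.F z - S.V z

/-- Minimum number of bits for every user, as a function of the SINR levels. -/
def C1 (S : System K M N NT) (z : Levels K M N) : Prop :=
  ∀ k, S.B k ≤ S.Fu k z - S.Vu k z

/-- Total power budget. -/
def C2 (S : System K M N NT) (W : Beams K M N NT) : Prop :=
  ∑ k, ∑ m, ∑ n, (Matrix.trace (W k m n)).re ≤ S.Pmax

/-- No transmission to user `k` after its first `D k` time slots. The slot with index `n : Fin N`
is slot number `n + 1`. -/
def C3 (S : System K M N NT) (W : Beams K M N NT) : Prop :=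
  ∀ k m, ∀ n : Fin N, S.D k < (n : ℕ) + 1 → Matrix.trace (W k m n) = 0

/-- Positive semidefiniteness. -/
def C4 (_S : System K M N NT) (W : Beams K M N NT) : Prop :=
  ∀ k m n, (W k m n).PosSemidef

/-- Rank at most one. -/
def C5 (_S : System K M N NT) (W : Beams K M N NT) : Prop :=
  ∀ k m n, (W k m n).rank ≤ 1

/-- The auxiliary variables bound the SINRs from below. -/
def C6 (S : System K M N NT) (W : Beams K M N NT) (z : Levels K M N) : Prop :=
  ∀ k m n, z k m n ≤ S.f W k m n / S.g W k m n

/-- The auxiliary variables are nonnegative. -/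
def C7 (_S : System K M N NT) (z : Levels K M N) : Prop :=
  ∀ k m n, 0 ≤ z k m n

/-- Feasible set of the rank-constrained semidefinite problem. -/
def rankFeasible (S : System K M N NT) : Set (Beams K M N NT) :=
  {W | S.C1 (S.γ W) ∧ S.C2 W ∧ S.C3 W ∧ S.C4 W ∧ S.C5 W}

/-- Feasible set of the relaxed problem, in the variables `(W, z)`. -/
def relaxedFeasible (S : System K M N NT) : Set (Beams K M N NT × Levels K M N) :=
  {p | S.C1 p.2 ∧ S.C2 p.1 ∧ S.C3 p.1 ∧ S.C4 p.1 ∧ S.C6 p.1 p.2 ∧ S.C7 p.2}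

/-- `W` is an optimal solution of the rank-constrained semidefinite problem: it is feasible and
maximizes the weighted sum throughput at the SINRs of `W` over the feasible set. -/
def IsRankOptimal (S : System K M N NT) (W : Beams K M N NT) : Prop :=
  W ∈ S.rankFeasible ∧ IsMaxOn (fun W' => S.U (S.γ W')) S.rankFeasible W

/-- `(W, z)` is an optimal solution of the relaxed problem: it is feasible and maximizes the
weighted sum throughput at the levels `z` over the feasible set. -/
def IsRelaxedOptimal (S : System K M N NT) (W : Beams K M N NT) (z : Levels K M N) : Prop :=
  (W, z) ∈ S.relaxedFeasible ∧ IsMaxOn (fun p => S.U p.2) S.relaxedFeasible (W, z)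

end System

end URLLC

end

/-! The crux is that a relaxed optimum leaves no power unused. Otherwise scale all beams by some `c
> 1`: the noise is not scaled, so every level stays admissible and every positive level gains slack.
A user's rate need not increase with each of its levels, since the penalty may grow faster than the
capacity. However, if the rate is positive, raising the user's largest level does increase it
(`lt_of_raise_largest`); a user with a positive bit requirement has such a rate. This contradicts
optimality (`exists_lt_of_power_lt`).

Hence beams that are smaller in the Loewner order and support the same levels must be the original
ones (`IsRelaxedOptimal.eq_of_le`), as a nonzero decrease would save power. Shrinking each beam by
the ratio of level to SINR gives equality in C6; compressing each beam along its own user's channel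
gives rank at most one.

So a relaxed optimum is feasible for the rank-constrained problem, which embeds into the relaxed one
by taking the levels to be the SINRs. Compactness of the relaxed feasible set gives existence and
the converse implication. -/

noncomputable section

/-! ### Positive semidefinite matrices and rank-one compression. -/

namespace Matrix

variable {n : Type*} [Fintype n]

/-- The compression `(Whh*W)/(h*Wh)` of `W` along `h`. -/
def compression (W : Matrix n n ℂ) (h : n → ℂ) : Matrix n n ℂ :=
  (star h ⬝ᵥ W *ᵥ h)⁻¹ • vecMulVec (W *ᵥ h) (star (W *ᵥ h))

theorem rank_compression_le (W : Matrix n n ℂ) (h : n → ℂ) : (W.compression h).rank ≤ 1 := by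
  rw [compression, ← smul_vecMulVec]
  exact rank_vecMulVec_le _ _

theorem PosSemidef.star_quadratic {W : Matrix n n ℂ} (hW : W.PosSemidef) (h : n → ℂ) :
    star (star h ⬝ᵥ W *ᵥ h) = star h ⬝ᵥ W *ᵥ h :=
  (IsSelfAdjoint.of_nonneg (hW.dotProduct_mulVec_nonneg h)).star_eq

theorem PosSemidef.compression {W : Matrix n n ℂ} (hW : W.PosSemidef) (h : n → ℂ) :
    (W.compression h).PosSemidef :=
  (posSemidef_vecMulVec_self_star _).smul (inv_nonneg.2 (hW.dotProduct_mulVec_nonneg h))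

/-- With `c = h*Wh`, the difference is the congruence `PᴴWP` for `P = 1 - c⁻¹ h(Wh)*`. The case `c =
0` needs no separate treatment: `c⁻¹ = 0` makes the compression vanish. -/
theorem PosSemidef.sub_compression {W : Matrix n n ℂ} (hW : W.PosSemidef) (h : n → ℂ) :
    (W - W.compression h).PosSemidef := by
  classical
  have hstar := hW.star_quadratic h
  have hrow : star h ᵥ* W = star (W *ᵥ h) := by
    rw [star_mulVec, hW.isHermitian.eq]
  set c := star h ⬝ᵥ W *ᵥ h with hc
  have key : W - W.compression h =
      (1 - c⁻¹ • vecMulVec h (star (W *ᵥ h)))ᴴ * W * (1 - c⁻¹ • vecMulVec h (star (W *ᵥ h))) := by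
    have hcc : c⁻¹ * (c⁻¹ * c) = c⁻¹ := by
      by_cases h0 : c = 0 <;> simp [h0]
    have h1 : (1 - c⁻¹ • vecMulVec h (star (W *ᵥ h)))ᴴ
        = 1 - c⁻¹ • vecMulVec (W *ᵥ h) (star h) := by
      rw [conjTranspose_sub, conjTranspose_smul, conjTranspose_vecMulVec, star_inv₀, hstar,
        conjTranspose_one, star_star]
    rw [h1, Matrix.mul_assoc, Matrix.mul_sub W, Matrix.mul_smul, mul_vecMulVec, Matrix.mul_one,
      Matrix.sub_mul, Matrix.one_mul, Matrix.smul_mul, Matrix.mul_sub, vecMulVec_mul, hrow,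
      Matrix.mul_smul, vecMulVec_mul_vecMulVec, ← hc, vecMulVec_smul, smul_sub, smul_smul,
      smul_smul, mul_assoc, hcc, sub_self, sub_zero, Matrix.compression]
  rw [key]
  exact hW.conjTranspose_mul_mul_same _

/-- Both sides equal `c = h*Wh`, the left one in the form `c⁻¹ * c * c`. Compression therefore
preserves the signal received over `h`. -/
theorem PosSemidef.trace_mul_compression {W : Matrix n n ℂ} (hW : W.PosSemidef) (h : n → ℂ) :
    trace (vecMulVec h (star h) * W.compression h) = trace (vecMulVec h (star h) * W) := by
  have hstar := hW.star_quadratic h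
  have hrow : star h ᵥ* W = star (W *ᵥ h) := by
    rw [star_mulVec, hW.isHermitian.eq]
  have hcol : h ⬝ᵥ star (W *ᵥ h) = star h ⬝ᵥ W *ᵥ h := by
    rw [← hstar, star_dotProduct, star_star, dotProduct_comm]
  set c := star h ⬝ᵥ W *ᵥ h with hc
  rw [vecMulVec_mul h (star h) W, hrow, Matrix.compression, Matrix.mul_smul, vecMulVec_mul_vecMulVec, ← hc,
    vecMulVec_smul, smul_smul, trace_smul, trace_vecMulVec, hcol]
  by_cases h0 : c = 0 <;> simp [h0]

theorem PosSemidef.re_trace_vecMulVec_mul_nonneg {W : Matrix n n ℂ} (hW : W.PosSemidef)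
    (h : n → ℂ) : 0 ≤ (trace (vecMulVec h (star h) * W)).re := by
  rw [vecMulVec_mul, trace_vecMulVec, dotProduct_comm, ← dotProduct_mulVec]
  exact (Complex.nonneg_iff.1 (hW.dotProduct_mulVec_nonneg h)).1

theorem PosSemidef.re_trace_nonneg {W : Matrix n n ℂ} (hW : W.PosSemidef) :
    0 ≤ (trace W).re :=
  (Complex.nonneg_iff.1 hW.trace_nonneg).1

theorem PosSemidef.re_trace_eq_zero_iff {W : Matrix n n ℂ} (hW : W.PosSemidef) :
    (trace W).re = 0 ↔ W = 0 := by
  rw [← hW.trace_eq_zero_iff, Complex.ext_iff]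
  simp [← (Complex.nonneg_iff.1 hW.trace_nonneg).2]

theorem PosSemidef.norm_apply_le_re_trace {W : Matrix n n ℂ} (hW : W.PosSemidef) (i j : n) :
    ‖W i j‖ ≤ (trace W).re := by
  have hdiag : ∀ i, 0 ≤ (W i i).re := fun i => (Complex.nonneg_iff.1 hW.diag_nonneg).1
  have himag : ∀ i, (W i i).im = 0 := fun i => (Complex.nonneg_iff.1 hW.diag_nonneg).2.symm
  have hle : ∀ i, (W i i).re ≤ (trace W).re := fun i => by
    rw [trace, Complex.re_sum]
    exact Finset.single_le_sum (f := fun i => (W i i).re) (fun i _ => hdiag i) (Finset.mem_univ i)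
  -- The 2×2 minor gives `|W i j|² ≤ W i i * W j j`; `submatrix` allows a repeated index, so `i = j`
  -- is covered.
  have hdet := (Complex.nonneg_iff.1 (hW.submatrix ![i, j]).det_nonneg).1
  have hji : W j i = star (W i j) := (hW.isHermitian.apply i j).symm ▸ (star_star _).symm
  simp only [det_fin_two, submatrix_apply, cons_val_zero, cons_val_one, hji, Complex.sub_re,
    Complex.mul_re, himag, Complex.star_def, Complex.conj_re, Complex.conj_im] at hdet
  have hsq : ‖W i j‖ ^ 2 ≤ (trace W).re ^ 2 := by
    rw [Complex.sq_norm, Complex.normSq_apply]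
    nlinarith [mul_le_mul (hle i) (hle j) (hdiag j) ((hdiag i).trans (hle i))]
  exact le_of_sq_le_sq hsq ((hdiag i).trans (hle i))

theorem isClosed_setOf_posSemidef : IsClosed {W : Matrix n n ℂ | W.PosSemidef} := by
  simp only [posSemidef_iff_dotProduct_mulVec, Set.ofPred_and, Set.ofPred_forall]
  refine (isClosed_eq (by fun_prop) (by fun_prop)).inter
    (isClosed_iInter fun x => isClosed_le (by fun_prop) (by fun_prop))

end Matrix

/-! ### Capacity gain against penalty growth. -/

namespace URLLC

/-- Replacing `x` by `y` in the capacity outweighs the resulting change of the penalty, if the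
capacity `L` is at least the penalty `q √P` and at most `P x²`. -/
theorem mul_sqrt_sub_lt_log {q L P x y : ℝ} (hx : 1 < x) (hxy : x < y) (hP : 0 < P)
    (hL : q * √P ≤ L) (hLP : L ≤ P * x ^ 2) :
    q * (√(P + (x⁻¹ ^ 2 - y⁻¹ ^ 2)) - √P) < Real.log y - Real.log x := by
  have hx0 : 0 < x := by linarith
  have hy0 : 0 < y := by linarith
  have hlog : 0 < Real.log y - Real.log x := sub_pos.2 (Real.log_lt_log hx0 hxy)
  have hinv : y⁻¹ < x⁻¹ := inv_strictAnti₀ hx0 hxy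
  have hd : 0 < x⁻¹ ^ 2 - y⁻¹ ^ 2 := by
    have := inv_pos.2 hy0
    nlinarith
  set d := x⁻¹ ^ 2 - y⁻¹ ^ 2 with hd_def
  set s := √P
  have hs : 0 < s := Real.sqrt_pos.2 hP
  have hss : s ^ 2 = P := Real.sq_sqrt hP.le
  set t := √(P + d)
  have htt : t ^ 2 = P + d := Real.sq_sqrt (by linarith)
  have hst : s < t := Real.sqrt_lt_sqrt hP.le (by linarith)
  rcases le_or_gt q 0 with hq | hq
  · nlinarith
  have h1 : q * s ≤ s ^ 2 * x ^ 2 := by rw [hss]; exact hL.trans hLP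
  have h2 : q ≤ s * x ^ 2 := by
    refine le_of_mul_le_mul_right ?_ hs
    linarith
  -- Strict concavity of the square root: `s(t - s) < (t² - s²)/2 = d/2`.
  have h3 : q * (t - s) < x ^ 2 * d / 2 := by
    have : s * (t - s) < d / 2 := by nlinarith [sq_pos_of_pos (sub_pos.2 hst)]
    calc q * (t - s) ≤ s * x ^ 2 * (t - s) := mul_le_mul_of_nonneg_right h2 (by linarith)
      _ = x ^ 2 * (s * (t - s)) := by ring
      _ < x ^ 2 * (d / 2) := by gcongr
      _ = x ^ 2 * d / 2 := by ring
  -- This is `log u ≥ 1 - u⁻¹` at `u = (y / x)²`; its constant matches the penalty bound exactly.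
  have h4 : x ^ 2 * d ≤ 2 * (Real.log y - Real.log x) := by
    have := Real.one_sub_inv_le_log_of_pos (x := (y / x) ^ 2) (by positivity)
    rw [Real.log_pow, Real.log_div hy0.ne' hx0.ne'] at this
    have e : x ^ 2 * d = 1 - ((y / x) ^ 2)⁻¹ := by
      rw [hd_def]; field_simp
    rw [e]; exact_mod_cast this
  linarith

/-- Summed over the resource elements, with `y` one plus the largest level, this yields the
hypothesis `L ≤ P x²` of `mul_sqrt_sub_lt_log`. -/
theorem log_le_one_sub_inv_sq_mul {x y : ℝ} (hx : 1 ≤ x) (hxy : x ≤ y) :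
    Real.log x ≤ (1 - x⁻¹ ^ 2) * y ^ 2 := by
  have hx0 : 0 < x := by linarith
  have hinv : x⁻¹ ^ 2 ≤ 1 := pow_le_one₀ (by positivity) (inv_le_one_of_one_le₀ hx)
  calc Real.log x ≤ x - 1 := Real.log_le_sub_one_of_pos hx0
    _ ≤ x ^ 2 - 1 := by nlinarith
    _ = (1 - x⁻¹ ^ 2) * x ^ 2 := by field_simp
    _ ≤ (1 - x⁻¹ ^ 2) * y ^ 2 := by
      have : 0 ≤ 1 - x⁻¹ ^ 2 := by linarith
      gcongr

/-- Raising the largest of the levels strictly increases `∑ log (1 + z) - q √(∑ (1 - (1+z)⁻²))`,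
as long as this quantity is positive. -/
theorem lt_of_raise_largest {ι : Type*} [Fintype ι] [DecidableEq ι] {q : ℝ} {z : ι → ℝ}
    (hz : ∀ i, 0 ≤ z i)
    (hpos : 0 < ∑ i, Real.log (1 + z i) - q * √(∑ i, (1 - (1 + z i)⁻¹ ^ 2)))
    {j : ι} (hj : ∀ i, z i ≤ z j) (hzj : 0 < z j) {t : ℝ} (ht : z j < t) :
    ∑ i, Real.log (1 + z i) - q * √(∑ i, (1 - (1 + z i)⁻¹ ^ 2)) <
      ∑ i, Real.log (1 + Function.update z j t i) -
        q * √(∑ i, (1 - (1 + Function.update z j t i)⁻¹ ^ 2)) := by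
  have hlog : ∑ i, Real.log (1 + Function.update z j t i) =
      ∑ i, Real.log (1 + z i) + (Real.log (1 + t) - Real.log (1 + z j)) := by
    rw [← Finset.add_sum_erase _ _ (Finset.mem_univ j),
      ← Finset.add_sum_erase _ (fun i => Real.log (1 + z i)) (Finset.mem_univ j),
      Finset.sum_congr rfl fun i hi => by rw [Function.update_of_ne (Finset.ne_of_mem_erase hi)],
      Function.update_self]
    ring
  have hvar : ∑ i, (1 - (1 + Function.update z j t i)⁻¹ ^ 2) =
      ∑ i, (1 - (1 + z i)⁻¹ ^ 2) + ((1 + z j)⁻¹ ^ 2 - (1 + t)⁻¹ ^ 2) := by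
    rw [← Finset.add_sum_erase _ _ (Finset.mem_univ j),
      ← Finset.add_sum_erase _ (fun i => 1 - (1 + z i)⁻¹ ^ 2) (Finset.mem_univ j),
      Finset.sum_congr rfl fun i hi => by rw [Function.update_of_ne (Finset.ne_of_mem_erase hi)],
      Function.update_self]
    ring
  have hterm : ∀ i, 0 ≤ 1 - (1 + z i)⁻¹ ^ 2 := fun i => by
    have h1 : 1 ≤ 1 + z i := by linarith [hz i]
    have : (1 + z i)⁻¹ ^ 2 ≤ 1 :=
      pow_le_one₀ (inv_nonneg.2 (by linarith)) (inv_le_one_of_one_le₀ h1)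
    linarith
  have hP : 0 < ∑ i, (1 - (1 + z i)⁻¹ ^ 2) := by
    refine Finset.sum_pos' (fun i _ => hterm i) ⟨j, Finset.mem_univ j, ?_⟩
    have h1 : 1 < 1 + z j := by linarith
    have : (1 + z j)⁻¹ ^ 2 < 1 :=
      pow_lt_one₀ (inv_nonneg.2 (by linarith)) (inv_lt_one_of_one_lt₀ h1) two_ne_zero
    linarith
  have hLP : ∑ i, Real.log (1 + z i) ≤ (∑ i, (1 - (1 + z i)⁻¹ ^ 2)) * (1 + z j) ^ 2 := by
    rw [Finset.sum_mul]
    exact Finset.sum_le_sum fun i _ =>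
      log_le_one_sub_inv_sq_mul (by linarith [hz i]) (by linarith [hj i])
  have := mul_sqrt_sub_lt_log (q := q) (y := 1 + t) (by linarith) (by linarith) hP
    (by linarith) hLP
  rw [hlog, hvar]
  linarith

end URLLC


/-! ### Consequences of optimality in the relaxed problem. -/

namespace URLLC

variable {K M N NT : ℕ}

theorem a_pos : 0 < a := by
  rw [a, Real.logb, Real.log_exp]
  exact div_pos one_pos (Real.log_pos one_lt_two)

namespace System

variable (S : System K M N NT)

theorem U_eq_sum (z : Levels K M N) : S.U z = ∑ k, S.μ k * (S.Fu k z - S.Vu k z) := by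
  simp only [U, F, V, mul_sub, Finset.sum_sub_distrib]

/-- Natural logarithms and a single index set put the rate in the form of `lt_of_raise_largest`. -/
theorem Fu_sub_Vu (k : Fin K) (z : Levels K M N) :
    S.Fu k z - S.Vu k z = a * (∑ p : Fin M × Fin N, Real.log (1 + z k p.1 p.2) -
      gaussianQInv (S.ε k) * √(∑ p : Fin M × Fin N, (1 - (1 + z k p.1 p.2)⁻¹ ^ 2))) := by
  have hlog : S.Fu k z = a * ∑ p : Fin M × Fin N, Real.log (1 + z k p.1 p.2) := by
    simp only [Fu, a, Real.logb, Real.log_exp, Fintype.sum_prod_type, Finset.mul_sum]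
    refine Finset.sum_congr rfl fun m _ => Finset.sum_congr rfl fun n _ => by ring
  have hpow : ∀ x : ℝ, x ^ (-2 : ℤ) = x⁻¹ ^ 2 := fun x => by
    rw [zpow_neg, inv_pow]; rfl
  rw [hlog, Vu]
  simp only [hpow, Fintype.sum_prod_type]
  ring

theorem Fu_sub_Vu_congr {k : Fin K} {z z' : Levels K M N} (h : z k = z' k) :
    S.Fu k z - S.Vu k z = S.Fu k z' - S.Vu k z' := by
  simp only [Fu_sub_Vu, h]

variable {S} {W W' : Beams K M N NT} {z : Levels K M N}

theorem f_nonneg (hW : S.C4 W) (k m n) : 0 ≤ S.f W k m n :=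
  (hW k m n).re_trace_vecMulVec_mul_nonneg _

theorem g_pos (hσ : 0 < S.σ) (hW : S.C4 W) (k m n) : 0 < S.g W k m n :=
  add_pos_of_nonneg_of_pos
    (Finset.sum_nonneg fun l _ => (hW l m n).re_trace_vecMulVec_mul_nonneg _) (pow_pos hσ 2)

theorem sq_le_g (hW : S.C4 W) (k m n) : S.σ ^ 2 ≤ S.g W k m n :=
  le_add_of_nonneg_left
    (Finset.sum_nonneg fun l _ => (hW l m n).re_trace_vecMulVec_mul_nonneg _)

theorem C6_iff (hσ : 0 < S.σ) (hW : S.C4 W) :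
    S.C6 W z ↔ ∀ k m n, z k m n * S.g W k m n ≤ S.f W k m n :=
  forall₃_congr fun k m n => le_div_iff₀ (g_pos hσ hW k m n)

theorem γ_nonneg (hσ : 0 < S.σ) (hW : S.C4 W) (k m n) : 0 ≤ S.γ W k m n :=
  div_nonneg (f_nonneg hW k m n) (g_pos hσ hW k m n).le

theorem f_smul (c : ℝ) (k m n) : S.f ((c : ℂ) • W) k m n = c * S.f W k m n := by
  simp [f, Matrix.trace_smul]

theorem g_smul (c : ℝ) (k m n) :
    S.g ((c : ℂ) • W) k m n = c * (S.g W k m n - S.σ ^ 2) + S.σ ^ 2 := by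
  simp [g, Matrix.trace_smul, Finset.mul_sum, mul_sub]

theorem g_mono (h : ∀ k m n, (W k m n - W' k m n).PosSemidef) (k m n) :
    S.g W' k m n ≤ S.g W k m n := by
  refine add_le_add_left (Finset.sum_le_sum fun l _ => ?_) _
  have := (h l m n).re_trace_vecMulVec_mul_nonneg (S.h k m)
  rw [Matrix.mul_sub, Matrix.trace_sub, Complex.sub_re] at this
  exact sub_nonneg.1 this

/-- If the power budget is not exhausted, then the throughput can be increased: scale all
beamforming matrices and raise the largest level of a user with a positive requirement. -/
theorem exists_lt_of_power_lt (hσ : 0 < S.σ) (hμ : ∀ k, 0 < S.μ k) (hB : ∃ k, 0 < S.B k)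
    (hfeas : (W, z) ∈ S.relaxedFeasible)
    (hlt : ∑ k, ∑ m, ∑ n, (Matrix.trace (W k m n)).re < S.Pmax) :
    ∃ p ∈ S.relaxedFeasible, S.U z < S.U p.2 := by
  obtain ⟨h1, -, h3, h4, h6, h7⟩ := hfeas
  dsimp only at h1 h3 h4 h6 h7
  obtain ⟨k, hk⟩ := hB
  have hrate := hk.trans_le (h1 k)
  obtain ⟨⟨m, n⟩, hzpos, hmax⟩ : ∃ p : Fin M × Fin N, 0 < z k p.1 p.2 ∧
      ∀ p' : Fin M × Fin N, z k p'.1 p'.2 ≤ z k p.1 p.2 := by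
    -- If all levels vanished, so would the rate, which is positive.
    have hne : ∃ p : Fin M × Fin N, z k p.1 p.2 ≠ 0 := by
      by_contra! h
      simp [Fu_sub_Vu, h] at hrate
    have : Nonempty (Fin M × Fin N) := ⟨hne.choose⟩
    obtain ⟨p, hp⟩ := Finite.exists_max fun p : Fin M × Fin N => z k p.1 p.2
    obtain ⟨p₀, hp₀⟩ := hne
    exact ⟨p, ((h7 k p₀.1 p₀.2).lt_of_ne' hp₀).trans_le (hp p₀), hp⟩
  dsimp only at hzpos hmax
  set P := ∑ k, ∑ m, ∑ n, (Matrix.trace (W k m n)).re with hP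
  have hP0 : 0 ≤ P := Finset.sum_nonneg fun k _ => Finset.sum_nonneg fun m _ =>
    Finset.sum_nonneg fun n _ => (h4 k m n).re_trace_nonneg
  obtain ⟨c, hc, hcP⟩ : ∃ c : ℝ, 1 < c ∧ c * P ≤ S.Pmax := by
    -- The denominator `P + 1` rather than `P` allows for zero power.
    refine ⟨1 + (S.Pmax - P) / (P + 1), ?_, ?_⟩
    · have : 0 < (S.Pmax - P) / (P + 1) := div_pos (by linarith) (by linarith)
      linarith
    · have : (S.Pmax - P) / (P + 1) * (P + 1) = S.Pmax - P := div_mul_cancel₀ _ (by linarith)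
      have : 0 < (S.Pmax - P) / (P + 1) := div_pos (by linarith) (by linarith)
      nlinarith
  have hc0 : 0 < c := one_pos.trans hc
  have h4' : S.C4 ((c : ℂ) • W) := fun k m n =>
    (h4 k m n).smul (by exact_mod_cast hc0.le)
  have hzg := (C6_iff hσ h4).1 h6
  have hσ2 := pow_pos hσ 2
  have h6' : S.C6 ((c : ℂ) • W) z := (C6_iff hσ h4').2 fun k m n => by
    rw [f_smul, g_smul]
    have := mul_le_mul_of_nonneg_left (hzg k m n) hc0.le
    have := mul_nonneg (mul_nonneg (h7 k m n) hσ2.le) (sub_pos.2 hc).le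
    nlinarith
  -- The scaled denominator is `c * g - (c - 1) * σ²`, so the slack in C6 is at least `z * (c - 1) *
  -- σ²`, positive here.
  have hlt' : z k m n < S.γ ((c : ℂ) • W) k m n := by
    rw [γ, lt_div_iff₀ (g_pos hσ h4' k m n), f_smul, g_smul]
    have := mul_le_mul_of_nonneg_left (hzg k m n) hc0.le
    have := mul_pos (mul_pos hzpos hσ2) (sub_pos.2 hc)
    nlinarith
  set t := S.γ ((c : ℂ) • W) k m n with ht
  -- Only the largest level moves, up to its new SINR; raising a smaller one could lower the rate.
  set z' : Levels K M N := Function.update z k fun m' n' =>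
    Function.update (fun p : Fin M × Fin N => z k p.1 p.2) (m, n) t (m', n') with hz'
  have hz'k : ∀ p : Fin M × Fin N, z' k p.1 p.2 =
      Function.update (fun p : Fin M × Fin N => z k p.1 p.2) (m, n) t p := fun p => by
    simp [hz']
  have hcases : ∀ k' m' n', z' k' m' n' = z k' m' n' ∨
      (k' = k ∧ m' = m ∧ n' = n ∧ z' k' m' n' = t) := fun k' m' n' => by
    by_cases hkk : k' = k
    · subst hkk
      by_cases hmn : (m', n') = (m, n)
      · obtain ⟨rfl, rfl⟩ := Prod.mk.inj hmn
        simp [hz']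
      · left
        rw [hz'k (m', n'), Function.update_of_ne hmn]
    · left
      rw [hz', Function.update_of_ne hkk]
  have hgain : S.Fu k z - S.Vu k z < S.Fu k z' - S.Vu k z' := by
    rw [Fu_sub_Vu] at hrate
    rw [Fu_sub_Vu, Fu_sub_Vu]
    simp only [hz'k]
    exact mul_lt_mul_of_pos_left (lt_of_raise_largest (z := fun p : Fin M × Fin N => z k p.1 p.2)
      (fun p => h7 k p.1 p.2) (pos_of_mul_pos_right hrate a_pos.le) hmax hzpos hlt') a_pos
  have hmono : ∀ l, S.Fu l z - S.Vu l z ≤ S.Fu l z' - S.Vu l z' := fun l => by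
    by_cases hl : l = k
    · exact hl ▸ hgain.le
    · exact (S.Fu_sub_Vu_congr (by rw [hz', Function.update_of_ne hl])).le
  refine ⟨((c : ℂ) • W, z'), ⟨fun l => (h1 l).trans (hmono l), ?_, ?_, h4', ?_, ?_⟩, ?_⟩
  · simpa [C2, Matrix.trace_smul, ← Finset.mul_sum] using hcP
  · intro l m' n' hn
    simp [Matrix.trace_smul, h3 l m' n' hn]
  · intro k' m' n'
    rcases hcases k' m' n' with h | ⟨rfl, rfl, rfl, h⟩
    · exact h.trans_le (h6' k' m' n')
    · exact h.le
  · intro k' m' n'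
    rcases hcases k' m' n' with h | ⟨rfl, rfl, rfl, h⟩
    · exact (h7 k' m' n').trans_eq h.symm
    · exact (hzpos.trans hlt').le.trans_eq h.symm
  · rw [U_eq_sum, U_eq_sum]
    exact Finset.sum_lt_sum (fun l _ => mul_le_mul_of_nonneg_left (hmono l) (hμ l).le)
      ⟨k, Finset.mem_univ k, mul_lt_mul_of_pos_left hgain (hμ k)⟩

/-- At an optimum of the relaxed problem no beamforming matrix can be decreased. -/
theorem IsRelaxedOptimal.eq_of_le (hσ : 0 < S.σ) (hμ : ∀ k, 0 < S.μ k) (hB : ∃ k, 0 < S.B k)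
    (hopt : S.IsRelaxedOptimal W z) (h4 : S.C4 W')
    (hle : ∀ k m n, (W k m n - W' k m n).PosSemidef) (h6 : S.C6 W' z) : W' = W := by
  obtain ⟨⟨h1, h2, h3, -, -, h7⟩, hmax⟩ := hopt
  have htr : ∀ k m n, (Matrix.trace (W' k m n)).re ≤ (Matrix.trace (W k m n)).re := fun k m n => by
    have := (hle k m n).re_trace_nonneg
    rw [Matrix.trace_sub, Complex.sub_re] at this
    exact sub_nonneg.1 this
  by_contra hne
  obtain ⟨k, m, n, hkmn⟩ : ∃ k m n, W' k m n ≠ W k m n := by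
    by_contra! h
    exact hne (funext fun k => funext fun m => funext fun n => h k m n)
  have hstrict : (Matrix.trace (W' k m n)).re < (Matrix.trace (W k m n)).re := by
    refine (htr k m n).lt_of_ne fun h => hkmn (sub_eq_zero.1 ?_).symm
    rw [← (hle k m n).re_trace_eq_zero_iff, Matrix.trace_sub, Complex.sub_re, h, sub_self]
  have hlt : ∑ k, ∑ m, ∑ n, (Matrix.trace (W' k m n)).re < S.Pmax := by
    refine lt_of_lt_of_le ?_ h2
    exact Finset.sum_lt_sum
      (fun k _ => Finset.sum_le_sum fun m _ => Finset.sum_le_sum fun n _ => htr k m n)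
      ⟨k, Finset.mem_univ k, Finset.sum_lt_sum (fun m _ => Finset.sum_le_sum fun n _ => htr k m n)
        ⟨m, Finset.mem_univ m, Finset.sum_lt_sum (fun n _ => htr k m n)
          ⟨n, Finset.mem_univ n, hstrict⟩⟩⟩
  -- The trace of `W'` is squeezed between zero and that of `W`.
  have h3' : S.C3 W' := fun k m n hn => by
    have h0 := htr k m n
    rw [h3 k m n hn, Complex.zero_re] at h0
    rw [(h4 k m n).trace_eq_zero_iff, ← (h4 k m n).re_trace_eq_zero_iff]
    exact le_antisymm h0 (h4 k m n).re_trace_nonneg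
  obtain ⟨p, hp, hlt⟩ := exists_lt_of_power_lt hσ hμ hB
    (show (W', z) ∈ S.relaxedFeasible from ⟨h1, hlt.le, h3', h4, h6, h7⟩) hlt
  exact absurd (hmax hp) (not_le.2 hlt)

/-- Scale each beam by `z / γ`. The new numerator is `z * g` with the old `g`, and interference only
drops, so C6 survives; since no decrease is possible, `z * g = f`. -/
theorem IsRelaxedOptimal.eq_γ (hσ : 0 < S.σ) (hμ : ∀ k, 0 < S.μ k) (hB : ∃ k, 0 < S.B k)
    (hopt : S.IsRelaxedOptimal W z) : z = S.γ W := by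
  have h4 : S.C4 W := hopt.1.2.2.2.1
  have h6 : S.C6 W z := hopt.1.2.2.2.2.1
  have h7 : S.C7 z := hopt.1.2.2.2.2.2
  set c : Levels K M N := fun k m n => z k m n / S.γ W k m n with hc
  have hc0 : ∀ k m n, 0 ≤ c k m n := fun k m n => div_nonneg (h7 k m n) (γ_nonneg hσ h4 k m n)
  have hc1 : ∀ k m n, c k m n ≤ 1 := fun k m n => div_le_one_of_le₀ (h6 k m n) (γ_nonneg hσ h4 k m n)
  set W' : Beams K M N NT := fun k m n => (c k m n : ℂ) • W k m n with hW'
  have hf : ∀ k m n, S.f W' k m n = z k m n * S.g W k m n := fun k m n => by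
    have : S.f W' k m n = c k m n * S.f W k m n := by simp [f, hW', Matrix.trace_smul]
    have hg := (g_pos hσ h4 k m n).ne'
    rw [this, hc]
    -- Without signal the ratio is `0 / 0 = 0`, which is harmless since C6 and C7 then force the
    -- level to be zero.
    by_cases hf0 : S.f W k m n = 0
    · have : z k m n = 0 :=
        le_antisymm ((h6 k m n).trans_eq (by rw [hf0, zero_div])) (h7 k m n)
      simp [hf0, this]
    · simp only [γ]; field_simp
  have hle : ∀ k m n, (W k m n - W' k m n).PosSemidef := fun k m n => by
    have : W k m n - W' k m n = ((1 - c k m n : ℝ) : ℂ) • W k m n := by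
      rw [hW', Complex.ofReal_sub, sub_smul, Complex.ofReal_one, one_smul]
    rw [this]
    exact (h4 k m n).smul (by exact_mod_cast sub_nonneg.2 (hc1 k m n))
  have h4' : S.C4 W' := fun k m n => (h4 k m n).smul (by exact_mod_cast hc0 k m n)
  have heq := hopt.eq_of_le hσ hμ hB h4' hle ((C6_iff hσ h4').2 fun k m n => by
    rw [hf]
    exact mul_le_mul_of_nonneg_left (g_mono hle k m n) (h7 k m n))
  funext k m n
  rw [γ, eq_div_iff (g_pos hσ h4 k m n).ne', ← hf, heq]

/-- Compressing each beam along its own user's channel keeps every numerator and does not increase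
any interference term, so the compressed beams are the original ones. -/
theorem IsRelaxedOptimal.rank_le_one (hσ : 0 < S.σ) (hμ : ∀ k, 0 < S.μ k) (hB : ∃ k, 0 < S.B k)
    (hopt : S.IsRelaxedOptimal W z) : S.C5 W := by
  have h4 : S.C4 W := hopt.1.2.2.2.1
  have h6 : S.C6 W z := hopt.1.2.2.2.2.1
  have h7 : S.C7 z := hopt.1.2.2.2.2.2
  set W' : Beams K M N NT := fun k m n => (W k m n).compression (S.h k m) with hW'
  have hle : ∀ k m n, (W k m n - W' k m n).PosSemidef := fun k m n =>
    (h4 k m n).sub_compression _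
  have h4' : S.C4 W' := fun k m n => (h4 k m n).compression _
  have heq := hopt.eq_of_le hσ hμ hB h4' hle ((C6_iff hσ h4').2 fun k m n => by
    have hf : S.f W' k m n = S.f W k m n :=
      congrArg Complex.re ((h4 k m n).trace_mul_compression _)
    rw [hf]
    exact (mul_le_mul_of_nonneg_left (g_mono hle k m n) (h7 k m n)).trans ((C6_iff hσ h4).1 h6 k m n))
  intro k m n
  rw [← heq]
  exact Matrix.rank_compression_le _ _

end System

end URLLC


/-! ### Compactness and existence of relaxed optima. -/

namespace URLLC

variable {K M N NT : ℕ}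

namespace System

variable {S : System K M N NT}

@[fun_prop]
theorem continuous_f (k m n) : Continuous fun W : Beams K M N NT => S.f W k m n := by
  unfold f; fun_prop

@[fun_prop]
theorem continuous_g (k m n) : Continuous fun W : Beams K M N NT => S.g W k m n := by
  unfold g; fun_prop

theorem norm_apply_le_of_C2 {W : Beams K M N NT} (h2 : S.C2 W) (h4 : S.C4 W) (k m n i j) :
    ‖W k m n i j‖ ≤ S.Pmax := by
  have hn : ∀ k m n, 0 ≤ (Matrix.trace (W k m n)).re := fun k m n => (h4 k m n).re_trace_nonneg
  calc ‖W k m n i j‖ ≤ (Matrix.trace (W k m n)).re := (h4 k m n).norm_apply_le_re_trace i j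
    _ ≤ ∑ n, (Matrix.trace (W k m n)).re :=
      Finset.single_le_sum (fun n _ => hn k m n) (Finset.mem_univ n)
    _ ≤ ∑ m, ∑ n, (Matrix.trace (W k m n)).re :=
      Finset.single_le_sum (f := fun m => ∑ n, (Matrix.trace (W k m n)).re)
        (fun m _ => Finset.sum_nonneg fun n _ => hn k m n) (Finset.mem_univ m)
    _ ≤ ∑ k, ∑ m, ∑ n, (Matrix.trace (W k m n)).re :=
      Finset.single_le_sum (f := fun k => ∑ m, ∑ n, (Matrix.trace (W k m n)).re)
        (fun k _ => Finset.sum_nonneg fun m _ => Finset.sum_nonneg fun n _ => hn k m n)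
        (Finset.mem_univ k)
    _ ≤ S.Pmax := h2

variable (S) in
/-- The beamforming matrices that satisfy C2, C3 and C4. -/
def beamSet : Set (Beams K M N NT) := {W | S.C2 W ∧ S.C3 W ∧ S.C4 W}

theorem isCompact_beamSet : IsCompact S.beamSet := by
  have hbox : IsCompact (Set.univ.pi fun _ : Fin K => Set.univ.pi fun _ : Fin M =>
      Set.univ.pi fun _ : Fin N => (Set.univ.pi fun _ : Fin NT => Set.univ.pi fun _ : Fin NT =>
        Metric.closedBall (0 : ℂ) S.Pmax : Set (Matrix (Fin NT) (Fin NT) ℂ))) :=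
    isCompact_univ_pi fun _ => isCompact_univ_pi fun _ => isCompact_univ_pi fun _ =>
      isCompact_univ_pi fun _ => isCompact_univ_pi fun _ => isCompact_closedBall _ _
  refine hbox.of_isClosed_subset ?_ ?_
  · have h2 : IsClosed {W : Beams K M N NT | S.C2 W} :=
      isClosed_le (by fun_prop) (by fun_prop)
    have h3 : IsClosed {W : Beams K M N NT | S.C3 W} := by
      simp only [C3, Set.ofPred_forall]
      exact isClosed_iInter fun k => isClosed_iInter fun m => isClosed_iInter fun n =>
        isClosed_iInter fun _ => isClosed_eq (by fun_prop) (by fun_prop)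
    have h4 : IsClosed {W : Beams K M N NT | S.C4 W} := by
      simp only [C4, Set.ofPred_forall]
      exact isClosed_iInter fun k => isClosed_iInter fun m => isClosed_iInter fun n =>
        Matrix.isClosed_setOf_posSemidef.preimage
          (f := fun W : Beams K M N NT => W k m n) (by fun_prop)
    exact h2.inter (h3.inter h4)
  · rintro W ⟨h2, -, h4⟩ k - m - n - i - j -
    simpa using norm_apply_le_of_C2 h2 h4 k m n i j

variable (S) in
/-- The pairs that satisfy all constraints of the relaxed problem except the rate constraint. -/
def levelSet : Set (Beams K M N NT × Levels K M N) :=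
  {p | p.1 ∈ S.beamSet ∧ (∀ k m n, p.2 k m n * S.g p.1 k m n ≤ S.f p.1 k m n) ∧ S.C7 p.2}

theorem isClosed_levelSet : IsClosed S.levelSet := by
  have h1 : IsClosed {p : Beams K M N NT × Levels K M N | p.1 ∈ S.beamSet} :=
    isCompact_beamSet.isClosed.preimage continuous_fst
  have h2 : IsClosed {p : Beams K M N NT × Levels K M N |
      ∀ k m n, p.2 k m n * S.g p.1 k m n ≤ S.f p.1 k m n} := by
    simp only [Set.ofPred_forall]
    exact isClosed_iInter fun k => isClosed_iInter fun m => isClosed_iInter fun n =>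
      isClosed_le (((by fun_prop : Continuous fun p : Beams K M N NT × Levels K M N =>
        p.2 k m n)).mul ((continuous_g k m n).comp continuous_fst))
        ((continuous_f k m n).comp continuous_fst)
  have h3 : IsClosed {p : Beams K M N NT × Levels K M N | S.C7 p.2} := by
    simp only [C7, Set.ofPred_forall]
    exact isClosed_iInter fun k => isClosed_iInter fun m => isClosed_iInter fun n =>
      isClosed_le (by fun_prop) (by fun_prop)
  exact h1.inter (h2.inter h3)

/-- The numerators are bounded on the compact beam set and the denominators are at least `σ²`, which
bounds the levels. -/
theorem isCompact_levelSet (hσ : 0 < S.σ) : IsCompact S.levelSet := by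
  have hb : ∀ k m n, ∃ C, ∀ W ∈ S.beamSet, S.f W k m n ≤ C := fun k m n => by
    obtain ⟨C, hC⟩ := isCompact_beamSet.exists_bound_of_continuousOn
      (continuous_f (S := S) k m n).continuousOn
    exact ⟨C, fun W hW => (le_abs_self _).trans (hC W hW)⟩
  choose C hC using hb
  have hbox : IsCompact (S.beamSet ×ˢ (Set.univ.pi fun k => Set.univ.pi fun m =>
      Set.univ.pi fun n => Set.Icc (0 : ℝ) (C k m n / S.σ ^ 2))) :=
    isCompact_beamSet.prod (isCompact_univ_pi fun _ => isCompact_univ_pi fun _ =>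
      isCompact_univ_pi fun _ => isCompact_Icc)
  refine hbox.of_isClosed_subset isClosed_levelSet ?_
  rintro ⟨W, z⟩ ⟨hW, h6, h7⟩
  refine ⟨hW, fun k _ m _ n _ => ⟨h7 k m n, ?_⟩⟩
  rw [le_div_iff₀ (pow_pos hσ 2)]
  exact (mul_le_mul_of_nonneg_left (sq_le_g hW.2.2 k m n) (h7 k m n)).trans
    ((h6 k m n).trans (hC k m n W hW))

/-- Nonnegative levels keep `1 + z` away from the singularity at zero. -/
theorem continuousOn_rate (k : Fin K) :
    ContinuousOn (fun p : Beams K M N NT × Levels K M N => S.Fu k p.2 - S.Vu k p.2)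
      S.levelSet := by
  have hz : ∀ m n, ContinuousOn (fun p : Beams K M N NT × Levels K M N => 1 + p.2 k m n)
      S.levelSet := fun m n => by fun_prop
  have h0 : ∀ m n, ∀ p ∈ S.levelSet, 1 + p.2 k m n ≠ 0 := fun m n p hp => by
    linarith [hp.2.2 k m n]
  simp only [Fu_sub_Vu]
  refine continuousOn_const.mul (ContinuousOn.sub ?_ (continuousOn_const.mul (.sqrt ?_)))
  · exact continuousOn_finsetSum _ fun q _ => (hz q.1 q.2).log (h0 q.1 q.2)
  · exact continuousOn_finsetSum _ fun q _ =>
      continuousOn_const.sub (((hz q.1 q.2).inv₀ (h0 q.1 q.2)).pow 2)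

theorem relaxedFeasible_eq (hσ : 0 < S.σ) : S.relaxedFeasible =
    S.levelSet ∩ {p | S.C1 p.2} := by
  ext ⟨W, z⟩
  constructor
  · rintro ⟨h1, h2, h3, h4, h6, h7⟩
    exact ⟨⟨⟨h2, h3, h4⟩, (C6_iff hσ h4).1 h6, h7⟩, h1⟩
  · rintro ⟨⟨⟨h2, h3, h4⟩, h6, h7⟩, h1⟩
    exact ⟨h1, h2, h3, h4, (C6_iff hσ h4).2 h6, h7⟩

theorem isCompact_relaxedFeasible (hσ : 0 < S.σ) : IsCompact S.relaxedFeasible := by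
  refine (isCompact_levelSet hσ).of_isClosed_subset ?_
    (relaxedFeasible_eq hσ ▸ Set.inter_subset_left)
  have hcont : ContinuousOn (fun (p : Beams K M N NT × Levels K M N) k =>
      S.Fu k p.2 - S.Vu k p.2) S.levelSet := continuousOn_pi.2 fun k => continuousOn_rate k
  rw [relaxedFeasible_eq hσ]
  exact hcont.preimage_isClosed_of_isClosed isClosed_levelSet (isClosed_Ici (a := S.B))

theorem exists_isRelaxedOptimal (hσ : 0 < S.σ) (hne : S.relaxedFeasible.Nonempty) :
    ∃ W z, S.IsRelaxedOptimal W z := by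
  have hcont : ContinuousOn (fun p => S.U p.2) S.relaxedFeasible := by
    simp only [U_eq_sum]
    exact (continuousOn_finsetSum _ fun k _ => continuousOn_const.mul (continuousOn_rate k)).mono
      (relaxedFeasible_eq hσ ▸ Set.inter_subset_left)
  obtain ⟨⟨W, z⟩, hmem, hmax⟩ := (isCompact_relaxedFeasible hσ).exists_isMaxOn hne hcont
  exact ⟨W, z, hmem, hmax⟩

/-! ### Transfer between the two problems. -/

theorem mem_relaxedFeasible_of_mem_rankFeasible (hσ : 0 < S.σ) {W : Beams K M N NT}
    (hW : W ∈ S.rankFeasible) : (W, S.γ W) ∈ S.relaxedFeasible := by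
  obtain ⟨h1, h2, h3, h4, -⟩ := hW
  have h6 : S.C6 W (S.γ W) := fun _ _ _ => le_rfl
  have h7 : S.C7 (S.γ W) := γ_nonneg hσ h4
  exact ⟨h1, h2, h3, h4, h6, h7⟩

theorem IsRelaxedOptimal.isRankOptimal (hσ : 0 < S.σ) (hμ : ∀ k, 0 < S.μ k)
    (hB : ∃ k, 0 < S.B k) {W : Beams K M N NT} {z : Levels K M N}
    (hopt : S.IsRelaxedOptimal W z) : S.IsRankOptimal W := by
  have hz : z = S.γ W := hopt.eq_γ hσ hμ hB
  have h5 : S.C5 W := hopt.rank_le_one hσ hμ hB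
  obtain ⟨⟨h1, h2, h3, h4, -⟩, hmax⟩ := hopt
  have h1' : S.C1 (S.γ W) := hz ▸ h1
  refine ⟨⟨h1', h2, h3, h4, h5⟩, isMaxOn_iff.2 fun W' hW' => ?_⟩
  have h : S.U (S.γ W') ≤ S.U z :=
    isMaxOn_iff.1 hmax (W', S.γ W') (mem_relaxedFeasible_of_mem_rankFeasible hσ hW')
  exact h.trans_eq (congrArg S.U hz)

theorem IsRelaxedOptimal.U_eq (hσ : 0 < S.σ) (hμ : ∀ k, 0 < S.μ k)
    (hB : ∃ k, 0 < S.B k) {W W' : Beams K M N NT} {z : Levels K M N}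
    (hopt : S.IsRelaxedOptimal W z) (hopt' : S.IsRankOptimal W') : S.U z = S.U (S.γ W') := by
  have hz : z = S.γ W := hopt.eq_γ hσ hμ hB
  refine le_antisymm ((congrArg S.U hz).trans_le ?_) ?_
  · exact isMaxOn_iff.1 hopt'.2 W (hopt.isRankOptimal hσ hμ hB).1
  · exact isMaxOn_iff.1 hopt.2 (W', S.γ W') (mem_relaxedFeasible_of_mem_rankFeasible hσ hopt'.1)

/-- Rank-optimality gives no direct comparison with points of higher rank. The comparison passes
through a relaxed optimum, which exists by compactness and has the same value. -/
theorem IsRankOptimal.isRelaxedOptimal (hσ : 0 < S.σ) (hμ : ∀ k, 0 < S.μ k)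
    (hB : ∃ k, 0 < S.B k) {W : Beams K M N NT} (hopt : S.IsRankOptimal W) :
    S.IsRelaxedOptimal W (S.γ W) := by
  have hmem := mem_relaxedFeasible_of_mem_rankFeasible hσ hopt.1
  obtain ⟨W', z', hopt'⟩ := exists_isRelaxedOptimal hσ ⟨_, hmem⟩
  exact ⟨hmem, fun p hp => (isMaxOn_iff.1 hopt'.2 p hp).trans_eq (hopt'.U_eq hσ hμ hB hopt)⟩

end System

end URLLC

end

theorem proposition1 {K M N NT : ℕ} (S : URLLC.System K M N NT)
    (hσ : 0 < S.σ)
    (hε : ∀ k, 0 < S.ε k ∧ S.ε k < 1 / 2)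
    (hμ : ∀ k, 0 < S.μ k)
    (hB : ∃ k, 0 < S.B k) :
    -- the two problems have the same optimal beamforming matrices
    (∀ W, S.IsRankOptimal W ↔ ∃ z, S.IsRelaxedOptimal W z) ∧
    -- at every optimum of the relaxed problem the SINR bounds hold with equality
    -- and the matrices have rank at most one
    (∀ W z, S.IsRelaxedOptimal W z →
      (∀ k m n, z k m n = S.γ W k m n) ∧ (∀ k m n, (W k m n).rank ≤ 1)) ∧
    -- the two problems have the same optimal value
    (∀ W z W', S.IsRelaxedOptimal W z → S.IsRankOptimal W' → S.U z = S.U (S.γ W')) ∧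
    -- optimal solutions exist as soon as one of the problems is feasible
    ((S.relaxedFeasible.Nonempty ∨ S.rankFeasible.Nonempty) →
      (∃ W z, S.IsRelaxedOptimal W z) ∧ ∃ W, S.IsRankOptimal W) := by

  refine ⟨fun W => ⟨fun h => ⟨_, h.isRelaxedOptimal hσ hμ hB⟩,
      fun ⟨z, h⟩ => h.isRankOptimal hσ hμ hB⟩,
    fun W z h => ⟨fun k m n => by rw [← h.eq_γ hσ hμ hB], h.rank_le_one hσ hμ hB⟩,
    fun W z W' h h' => h.U_eq hσ hμ hB h', fun hne => ?_⟩
  obtain ⟨W, z, h⟩ := URLLC.System.exists_isRelaxedOptimal hσ <| hne.elim id fun ⟨W, hW⟩ =>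
    ⟨_, URLLC.System.mem_relaxedFeasible_of_mem_rankFeasible hσ hW⟩
  exact ⟨⟨W, z, h⟩, W, h.isRankOptimal hσ hμ hB⟩
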